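/- A Galois structure $\Gamma=(\mathbb{C},\mathbb{X},H,I,\eta,\mathcal{E})$ consists of a category $\mathbb{C}$, a full replete reflective subcategory $\mathbb{X}$ of $\mathbb{C}$ with inclusion functor $H\colon\mathbb{X}\to\mathbb{C}$, left adjoint $I\colon\mathbb{C}\to\mathbb{X}$ and reflection unit $\eta_A\colon A\to HI(A)$, and a class $\mathcal{E}$ of morphisms of $\mathbb{C}$ that contains all isomorphisms, is closed under composition, satisfies $HI(\mathcal{E})\subseteq\mathcal{E}$, and is pullback-stable, i.e. the pullback of a morphism in $\mathcal{E}$ along any morphism of $\mathbb{C}$ exists and lies in $\mathcal{E}$. For an object $B$ of $\mathbb{C}$, let $(\mathbb{C}\downarrow B)$ be the full subcategory of the slice category $\mathbb{C}/B$ on the morphisms $f\colon A\to B$ in $\mathcal{E}$; for an object $Y$ of $\mathbb{X}$, let $(\mathbb{X}\downarrow Y)$ be the full subcategory of $\mathbb{X}/Y$ on the morphisms $\varphi$ with $H(\varphi)\in\mathcal{E}$. Let $H^B\colon(\mathbb{X}\downarrow I(B))\to(\mathbb{C}\downarrow B)$ be the functor that sends $\varphi$ to the pullback of $H(\varphi)$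 along $\eta_B$; $\Gamma$ is admissible if $H^B$ is fully faithful for every $B$. A monadic extension of $B$ is a morphism $p\colon E\to B$ in $\mathcal{E}$ such that the pullback functor $p^*\colon(\mathbb{C}\downarrow B)\to(\mathbb{C}\downarrow E)$ is monadic. A trivial covering of $B$ is a morphism $f\colon A\to B$ in $\mathcal{E}$ such that the square $HI(f)\circ\eta_A=\eta_B\circ f$ is a pullback. A morphism $f\colon A\to B$ in $\mathcal{E}$ is split by a monadic extension $p\colon E\to B$ if $p^*(f)$ is a trivial covering of $E$; it is a covering if it is split by some monadic extension of $B$; and a normal extension is a monadic extension that is split by itself. Let $\mathsf{Ext}(\mathbb{C})$ and $\mathsf{Cov}_\Gamma(\mathbb{C})$ be the full subcategories of the arrow category of $\mathbb{C}$ on the morphisms in $\mathcal{E}$ and on the coverings, respectively. **Theorem.** Let $\Gamma=(\mathbb{C},\mathbb{X},H,I,\eta,\mathcal{E})$ be an admissible Galois structure such that every morphism in $\mathcal{E}$ is a monadic extension, and such that $I\colon\mathbb{C}\to\mathbb{X}$ preserves the pullback of $f\colon A\to B$ and $g\colon D\to B$ whenever $f,g\in\mathcal{E}$ and $g$ is a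 split epimorphism. Then the inclusion functor $\mathsf{Cov}_\Gamma(\mathbb{C})\to\mathsf{Ext}(\mathbb{C})$ has a left adjoint and, moreover, every covering is a normal extension. -/

import Mathlib

open CategoryTheory CategoryTheory.Limits

universe v u

/-- A Galois structure on a category `C`: a full replete reflective subcategory (given by the object
property `X`, with inclusion `X.ι`), a chosen reflector `I` with its adjunction to the inclusion,
and a class `E` of morphisms which contains the isomorphisms, is pullback-stable (pullbacks along
arbitrary morphisms exist and stay in the class), is closed under composition, and is preserved by
the reflector. -/
structure GaloisStructure (C : Type u) [Category.{v} C] where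
  /-- the objects of the subcategory -/
  X : ObjectProperty C
  replete : X.IsClosedUnderIsomorphisms
  /-- the reflector -/
  I : C ⥤ X.FullSubcategory
  /-- the adjunction whose unit is the reflection unit -/
  adj : I ⊣ X.ι
  /-- the class of extensions -/
  E : MorphismProperty C
  isomorphisms_le : MorphismProperty.isomorphisms C ≤ E
  hasPullbacks : E.HasPullbacks
  stable : E.IsStableUnderBaseChange
  comp : E.IsStableUnderComposition
  map_mem : ∀ {A B : C} (f : A ⟶ B), E f → E (X.ι.map (I.map f))

namespace GaloisStructure

variable {C : Type u} [Category.{v} C] (Γ : GaloisStructure C)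

instance : Γ.E.HasPullbacks := Γ.hasPullbacks

instance : Γ.E.IsStableUnderBaseChange := Γ.stable

/-- The inclusion functor of the reflective subcategory. -/
abbrev H : Γ.X.FullSubcategory ⥤ C := Γ.X.ι

/-- The reflection unit `A ⟶ HI(A)`. -/
abbrev η (A : C) : A ⟶ Γ.H.obj (Γ.I.obj A) := Γ.adj.unit.app A

/-- The full subcategory `(C ↓ B)` of the slice category over `B` on the morphisms of `E`. -/
abbrev Slice (B : C) : Type (max u v) := Γ.E.Over ⊤ B

/-- The full subcategory `(X ↓ Y)` of the slice category of the reflective subcategory over `Y` on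
the morphisms `φ` with `H(φ)` in `E`. -/
abbrev SliceX (Y : Γ.X.FullSubcategory) : Type (max u v) := (Γ.E.inverseImage Γ.H).Over ⊤ Y

/-- The pullback functor `p^* : (C ↓ B) ⥤ (C ↓ E)` along an arbitrary morphism `p : E ⟶ B`. -/
noncomputable abbrev pullbackFunctor {E B : C} (p : E ⟶ B) : Γ.Slice B ⥤ Γ.Slice E :=
  MorphismProperty.Over.pullback Γ.E ⊤ p

/-- The functor `(X ↓ Y) ⥤ (C ↓ H(Y))` which applies `H`. -/
def sliceInclusion (Y : Γ.X.FullSubcategory) : Γ.SliceX Y ⥤ Γ.Slice (Γ.H.obj Y) where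
  obj φ := MorphismProperty.Over.mk ⊤ (Γ.H.map φ.hom) φ.prop
  map a := MorphismProperty.Over.homMk (Γ.H.map a.left)
    ((Γ.H.map_comp _ _).symm.trans (congrArg Γ.H.map (MorphismProperty.Over.w a)))
  map_id φ := by ext; rfl
  map_comp a b := by ext; rfl

/-- The functor `H^B : (X ↓ I(B)) ⥤ (C ↓ B)`, which sends `φ` to the pullback of `H(φ)` along the
reflection unit `η_B`. -/
noncomputable def HB (B : C) : Γ.SliceX (Γ.I.obj B) ⥤ Γ.Slice B :=
  Γ.sliceInclusion (Γ.I.obj B) ⋙ Γ.pullbackFunctor (Γ.η B)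

/-- `Γ` is admissible if all the functors `H^B` are fully faithful. -/
def IsAdmissible : Prop := ∀ B : C, (Γ.HB B).Full ∧ (Γ.HB B).Faithful

/-- An object `(E, p)` of `(C ↓ B)` is a monadic extension if `p^* : (C ↓ B) ⥤ (C ↓ E)` is
monadic. -/
def IsMonadicExtension {B : C} (p : Γ.Slice B) : Prop :=
  Nonempty (MonadicRightAdjoint (Γ.pullbackFunctor p.hom))

/-- An object `(A, f)` of `(C ↓ B)` is a trivial covering if the naturality square of the reflection
unit at `f` is a pullback. -/
def IsTrivialCovering {B : C} (f : Γ.Slice B) : Prop :=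
  IsPullback (Γ.η f.left) f.hom (Γ.H.map (Γ.I.map f.hom)) (Γ.η B)

/-- `(A, f)` is split by `(E, p)` if `p^*(A, f)` is a trivial covering of `E`. -/
def IsSplitBy {B : C} (f p : Γ.Slice B) : Prop :=
  Γ.IsTrivialCovering ((Γ.pullbackFunctor p.hom).obj f)

/-- `(A, f)` is a covering of `B` if it is split by some monadic extension of `B`. -/
def IsCovering {B : C} (f : Γ.Slice B) : Prop :=
  ∃ p : Γ.Slice B, Γ.IsMonadicExtension p ∧ Γ.IsSplitBy f p

/-- A normal extension is a monadic extension which is split by itself. -/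
def IsNormalExtension {B : C} (p : Γ.Slice B) : Prop :=
  Γ.IsMonadicExtension p ∧ Γ.IsSplitBy p p

/-- The arrows which are in `E`. -/
def extProperty : ObjectProperty (Arrow C) := fun a ↦ Γ.E a.hom

/-- The arrows which are coverings (of their codomain). -/
def covProperty : ObjectProperty (Arrow C) := fun a ↦
  ∃ h : Γ.E a.hom, Γ.IsCovering (MorphismProperty.Over.mk ⊤ a.hom h)

/-- `Ext(C)`, as a full subcategory of the arrow category. -/
abbrev Ext : Type (max u v) := Γ.extProperty.FullSubcategory

/-- `Cov_Γ(C)`, as a full subcategory of the arrow category. -/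
abbrev Cov : Type (max u v) := Γ.covProperty.FullSubcategory

lemma covProperty_le_extProperty : Γ.covProperty ≤ Γ.extProperty := fun _ h ↦ h.1

/-- The inclusion functor `Cov_Γ(C) ⥤ Ext(C)`. -/
abbrev covInclusion : Γ.Cov ⥤ Γ.Ext := ObjectProperty.ιOfLE Γ.covProperty_le_extProperty

end GaloisStructure

/-! Let W be the class of morphisms inverted by `I`. Admissibility gives each extension of `E` a
reflection to a trivial covering with unit in W, and trivial coverings are local for W. For an
extension `p : E ⟶ B`, the monad `p^* p_!` pulls back along a kernel pair projection of `p`. This is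
a split epimorphism, so `I` preserves the pullback and the monad preserves W. The reflection
therefore lifts to algebras, and by monadicity the extensions split by `p` are reflective over `B`
(`exists_isSplitBy_reflection`). The same preservation shows that a split epimorphic extension with
a trivial pullback along an extension is itself trivial. Applied to a kernel pair projection, this
makes every covering normal (`IsCovering.isSplitBy_self`). Finally, reflect `f` into the extensions
split by `f` itself. If `f` maps to a covering `g` over `b`, normality of `g` forces `b^*(g)` to be
split by `f`, so this reflection is universal among all coverings. -/

/-! ### Lifting reflections along monadic functors -/

section Monadic

universe v₁ v₂ u₁ u₂

variable {A : Type u₁} [Category.{v₁} A] {D : Type u₂} [Category.{v₂} D]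

/-- If the monad of a monadic functor `R` preserves a class `W` of morphisms, and `P` is reflective
with reflection units in `W` and all its objects `W`-local, then the objects `d` such that `R d` is
in `P` are reflective. -/
theorem CategoryTheory.MonadicRightAdjoint.exists_reflection (R : D ⥤ A) [MonadicRightAdjoint R]
    (P : ObjectProperty A) [P.IsClosedUnderIsomorphisms] (W : MorphismProperty A)
    (hW : ∀ {X Y : A} (g : X ⟶ Y), W g → W (R.map ((monadicLeftAdjoint R).map g)))
    (hloc : ∀ {X Y Z : A} (g : X ⟶ Y), W g → P Z → Function.Bijective fun t : Y ⟶ Z ↦ g ≫ t)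
    (hrefl : ∀ X : A, ∃ (Y : A) (g : X ⟶ Y), W g ∧ P Y) (d : D) :
    ∃ (d' : D) (r : d ⟶ d'), P (R.obj d') ∧
      ∀ d'' : D, P (R.obj d'') → Function.Bijective fun t : d' ⟶ d'' ↦ r ≫ t := by
  let T := (monadicAdjunction R).toMonad
  let K := Monad.comparison (monadicAdjunction R)
  have hT : ∀ {X Y : A} (g : X ⟶ Y), W g → W (T.map g) := hW
  let M : T.Algebra := K.obj d
  obtain ⟨Y, g, hg, hY⟩ := hrefl M.A
  -- `T.map g` stays in `W`, so the structure map of `M` extends uniquely to `Y`; the algebra laws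
  -- can then be tested after precomposing with `g` or `T (T g)`.
  obtain ⟨b, hb : T.map g ≫ b = M.a ≫ g⟩ := (hloc (T.map g) (hT g hg) hY).2 (M.a ≫ g)
  let N : T.Algebra :=
    { A := Y
      a := b
      unit := by
        apply (hloc g hg hY).1
        have := T.η.naturality g
        dsimp at this ⊢
        rw [reassoc_of% this, hb, M.unit_assoc, Category.comp_id]
      assoc := by
        apply (hloc _ (hT _ (hT g hg)) hY).1
        have := T.μ.naturality g
        dsimp at this ⊢
        rw [reassoc_of% this, hb, M.assoc_assoc, ← Functor.map_comp_assoc, hb,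
          Functor.map_comp_assoc, hb] }
  let q : M ⟶ N := { f := g, h := hb }
  have hq : ∀ Q : T.Algebra, P Q.A → Function.Bijective fun t : N ⟶ Q ↦ q ≫ t := by
    intro Q hQ
    constructor
    · intro s t hst
      ext
      exact (hloc g hg hQ).1 (congrArg Monad.Algebra.Hom.f hst)
    · intro s
      obtain ⟨t, ht : g ≫ t = s.f⟩ := (hloc g hg hQ).2 s.f
      refine ⟨{ f := t, h := ?_ }, ?_⟩
      · apply (hloc _ (hT g hg) hQ).1
        change T.map g ≫ T.map t ≫ Q.a = T.map g ≫ b ≫ t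
        rw [← Functor.map_comp_assoc, ht, reassoc_of% hb, ht, s.h]
      · ext
        exact ht
  let e : K.obj (K.objPreimage N) ≅ N := K.objObjPreimageIso N
  obtain ⟨r, hr⟩ := K.map_surjective (q ≫ e.inv)
  refine ⟨K.objPreimage N, r, P.prop_of_iso (T.forget.mapIso e).symm hY, fun d'' hd'' ↦ ?_⟩
  constructor
  · intro s t hst
    apply K.map_injective
    rw [← cancel_epi e.inv]
    apply (hq (K.obj d'') hd'').1
    have := congrArg K.map hst
    simpa [hr] using this
  · intro s
    obtain ⟨t, ht : q ≫ t = K.map s⟩ := (hq (K.obj d'') hd'').2 (K.map s)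
    obtain ⟨t', ht'⟩ := K.map_surjective (e.hom ≫ t)
    refine ⟨t', K.map_injective ?_⟩
    simp [hr, ht', ht]

end Monadic

/-! ### Trivial coverings as local objects -/

namespace GaloisStructure

variable {C : Type u} [Category.{v} C] (Γ : GaloisStructure C)

lemma η_naturality {A B : C} (f : A ⟶ B) :
    Γ.η A ≫ Γ.H.map (Γ.I.map f) = f ≫ Γ.η B :=
  (Γ.adj.unit.naturality f).symm

lemma reflection_hom_ext {A : C} {Y : Γ.X.FullSubcategory} {s t : Γ.I.obj A ⟶ Y}
    (h : Γ.η A ≫ Γ.H.map s = Γ.η A ≫ Γ.H.map t) : s = t :=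
  (Γ.adj.homEquiv A Y).injective (by rwa [Adjunction.homEquiv_unit, Adjunction.homEquiv_unit])

lemma exists_reflection_desc {A : C} {Y : Γ.X.FullSubcategory} (u : A ⟶ Γ.H.obj Y) :
    ∃ t : Γ.I.obj A ⟶ Y, Γ.η A ≫ Γ.H.map t = u :=
  ⟨(Γ.adj.homEquiv A Y).symm u, by
    rw [← Adjunction.homEquiv_unit, Equiv.apply_symm_apply]⟩

/-- The naturality square of the reflection unit at `f` is a pullback. -/
abbrev IsTrivial {A B : C} (f : A ⟶ B) : Prop :=
  IsPullback (Γ.η A) f (Γ.H.map (Γ.I.map f)) (Γ.η B)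

variable {Γ}

/-- By the pullback square, a map into `Z` is determined by its composite with `z` and its image
under `I`. With `IsTrivial.exists_lift`, this is locality over `B` for the morphisms inverted by
`I`. -/
lemma IsTrivial.hom_ext {Z B X Y : C} {z : Z ⟶ B} (hz : Γ.IsTrivial z) {g : X ⟶ Y}
    (hg : IsIso (Γ.I.map g)) {s t : Y ⟶ Z} (h : g ≫ s = g ≫ t) (h' : s ≫ z = t ≫ z) :
    s = t := by
  have : Γ.I.map s = Γ.I.map t := by
    rw [← cancel_epi (Γ.I.map g), ← Functor.map_comp, h, Functor.map_comp]
  refine IsPullback.hom_ext hz ?_ h'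
  rw [← η_naturality, ← η_naturality, this]

lemma IsTrivial.exists_lift {Z B X Y : C} {z : Z ⟶ B} (hz : Γ.IsTrivial z) {g : X ⟶ Y}
    (hg : IsIso (Γ.I.map g)) (x : X ⟶ Z) (y : Y ⟶ B) (h : x ≫ z = g ≫ y) :
    ∃ t : Y ⟶ Z, g ≫ t = x ∧ t ≫ z = y := by
  have w : (Γ.η Y ≫ Γ.H.map (inv (Γ.I.map g) ≫ Γ.I.map x)) ≫ Γ.H.map (Γ.I.map z) =
      y ≫ Γ.η B := by
    rw [← η_naturality, Category.assoc, ← Functor.map_comp, Category.assoc, ← Functor.map_comp Γ.I,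
      h, Functor.map_comp Γ.I, IsIso.inv_hom_id_assoc]
  refine ⟨IsPullback.lift hz _ y w, IsPullback.hom_ext hz ?_ ?_, IsPullback.lift_snd _ _ _ _⟩
  · rw [Category.assoc, IsPullback.lift_fst, ← reassoc_of% η_naturality Γ g, ← Functor.map_comp,
      IsIso.hom_inv_id_assoc, η_naturality]
  · rw [Category.assoc, IsPullback.lift_snd, h]

lemma IsTrivial.of_iso {A A' B : C} {f : A ⟶ B} (hf : Γ.IsTrivial f) {f' : A' ⟶ B} (e : A' ≅ A)
    (w : e.hom ≫ f = f') : Γ.IsTrivial f' :=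
  IsPullback.of_iso hf e.symm (Γ.H.mapIso (Γ.I.mapIso e.symm)) (Iso.refl _) (Iso.refl _)
    (Γ.η_naturality e.inv) (by simp [← w])
    (by simp [← w, ← ObjectProperty.FullSubcategory.comp_hom, ← Functor.map_comp]) (by simp)

/-! ### Admissibility and reflection to trivial coverings -/

variable (Γ) in
/-- The projection from `H^B(φ)` to the domain of `φ`. -/
noncomputable def HBfst {B : C} (φ : Γ.SliceX (Γ.I.obj B)) :
    ((Γ.HB B).obj φ).left ⟶ Γ.H.obj φ.left :=
  pullback.fst ((Γ.sliceInclusion _).obj φ).hom (Γ.η B)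

lemma isPullback_HB {B : C} (φ : Γ.SliceX (Γ.I.obj B)) :
    IsPullback (Γ.HBfst φ) ((Γ.HB B).obj φ).hom (Γ.H.map φ.hom) (Γ.η B) :=
  IsPullback.of_hasPullback ((Γ.sliceInclusion _).obj φ).hom (Γ.η B)

lemma HB_map_fst {B : C} {φ ψ : Γ.SliceX (Γ.I.obj B)} (σ : φ ⟶ ψ) :
    ((Γ.HB B).map σ).left ≫ Γ.HBfst ψ = Γ.HBfst φ ≫ Γ.H.map σ.left :=
  pullback.lift_fst (f := ((Γ.sliceInclusion _).obj ψ).hom) (g := Γ.η B) _ _ _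

/-- Fullness of `H^B`, for an arbitrary choice of pullbacks. -/
lemma IsAdmissible.exists_map (hadm : Γ.IsAdmissible) {B P P' : C} {Y Y' : Γ.X.FullSubcategory}
    {φ : Y ⟶ Γ.I.obj B} {φ' : Y' ⟶ Γ.I.obj B} {q : P ⟶ Γ.H.obj Y} {s : P ⟶ B}
    {q' : P' ⟶ Γ.H.obj Y'} {s' : P' ⟶ B} (h : IsPullback q s (Γ.H.map φ) (Γ.η B))
    (h' : IsPullback q' s' (Γ.H.map φ') (Γ.η B)) (hφ : Γ.E (Γ.H.map φ)) (hφ' : Γ.E (Γ.H.map φ'))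
    (r : P ⟶ P') (hr : r ≫ s' = s) : ∃ σ : Y ⟶ Y', σ ≫ φ' = φ ∧ r ≫ q' = q ≫ Γ.H.map σ := by
  let α : Γ.SliceX (Γ.I.obj B) := MorphismProperty.Over.mk ⊤ φ hφ
  let β : Γ.SliceX (Γ.I.obj B) := MorphismProperty.Over.mk ⊤ φ' hφ'
  let q₁ : ((Γ.HB B).obj α).left ⟶ Γ.H.obj Y := Γ.HBfst α
  let s₁ : ((Γ.HB B).obj α).left ⟶ B := ((Γ.HB B).obj α).hom
  have hα : IsPullback q₁ s₁ (Γ.H.map φ) (Γ.η B) := isPullback_HB α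
  let q₂ : ((Γ.HB B).obj β).left ⟶ Γ.H.obj Y' := Γ.HBfst β
  let s₂ : ((Γ.HB B).obj β).left ⟶ B := ((Γ.HB B).obj β).hom
  have hβ : IsPullback q₂ s₂ (Γ.H.map φ') (Γ.η B) := isPullback_HB β
  let l : ((Γ.HB B).obj α).left ⟶ P := h.lift q₁ s₁ hα.w
  let l' : P ⟶ ((Γ.HB B).obj α).left := hα.lift q s h.w
  let m : P' ⟶ ((Γ.HB B).obj β).left := hβ.lift q' s' h'.w
  have hl : l' ≫ l = 𝟙 P := h.hom_ext
    (by rw [Category.assoc, h.lift_fst, hα.lift_fst, Category.id_comp])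
    (by rw [Category.assoc, h.lift_snd, hα.lift_snd, Category.id_comp])
  let ρ : (Γ.HB B).obj α ⟶ (Γ.HB B).obj β := MorphismProperty.Over.homMk (l ≫ r ≫ m) <| by
    change (l ≫ r ≫ m) ≫ s₂ = s₁
    rw [Category.assoc, Category.assoc, hβ.lift_snd, hr, h.lift_snd]
  have := (hadm B).1
  obtain ⟨σ, hσ⟩ := (Γ.HB B).map_surjective ρ
  have hσ' := HB_map_fst σ
  rw [hσ] at hσ'
  let σ₀ : Y ⟶ Y' := σ.left
  have hρ : (l ≫ r ≫ m) ≫ q₂ = q₁ ≫ Γ.H.map σ₀ := hσ'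
  refine ⟨σ₀, MorphismProperty.Over.w σ, ?_⟩
  rw [← hα.lift_fst q s h.w, Category.assoc, ← hρ, Category.assoc, reassoc_of% hl, Category.assoc,
    hβ.lift_fst]

/-- Faithfulness of `H^B`, for an arbitrary choice of pullbacks. -/
lemma IsAdmissible.hom_ext (hadm : Γ.IsAdmissible) {B P : C} {Y Y' : Γ.X.FullSubcategory}
    {φ : Y ⟶ Γ.I.obj B} {φ' : Y' ⟶ Γ.I.obj B} {q : P ⟶ Γ.H.obj Y} {s : P ⟶ B}
    (h : IsPullback q s (Γ.H.map φ) (Γ.η B)) (hφ : Γ.E (Γ.H.map φ)) (hφ' : Γ.E (Γ.H.map φ'))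
    {σ τ : Y ⟶ Y'} (hσ : σ ≫ φ' = φ) (hτ : τ ≫ φ' = φ)
    (hστ : q ≫ Γ.H.map σ = q ≫ Γ.H.map τ) : σ = τ := by
  let α : Γ.SliceX (Γ.I.obj B) := MorphismProperty.Over.mk ⊤ φ hφ
  let β : Γ.SliceX (Γ.I.obj B) := MorphismProperty.Over.mk ⊤ φ' hφ'
  let q₁ : ((Γ.HB B).obj α).left ⟶ Γ.H.obj Y := Γ.HBfst α
  let s₁ : ((Γ.HB B).obj α).left ⟶ B := ((Γ.HB B).obj α).hom
  have hα : IsPullback q₁ s₁ (Γ.H.map φ) (Γ.η B) := isPullback_HB α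
  let l : ((Γ.HB B).obj α).left ⟶ P := h.lift q₁ s₁ hα.w
  have hl : l ≫ q = q₁ := h.lift_fst _ _ _
  let σ' : α ⟶ β := MorphismProperty.Over.homMk σ hσ
  let τ' : α ⟶ β := MorphismProperty.Over.homMk τ hτ
  have := (hadm B).2
  have e : σ' = τ' := by
    apply (Γ.HB B).map_injective
    ext
    refine (isPullback_HB β).hom_ext ?_ ?_
    · refine (HB_map_fst σ').trans (Eq.trans ?_ (HB_map_fst τ').symm)
      change q₁ ≫ Γ.H.map σ = q₁ ≫ Γ.H.map τ
      rw [← hl, Category.assoc, hστ, Category.assoc]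
    · exact (MorphismProperty.Over.w ((Γ.HB B).map σ')).trans
        (MorphismProperty.Over.w ((Γ.HB B).map τ')).symm
  exact congrArg (fun a ↦ a.left) e

/-- The counit of the adjunction `I^B ⊣ H^B` is invertible. -/
lemma IsAdmissible.isIso_of_isPullback (hadm : Γ.IsAdmissible) {B P : C}
    {Y : Γ.X.FullSubcategory} {φ : Y ⟶ Γ.I.obj B} {q : P ⟶ Γ.H.obj Y} {s : P ⟶ B}
    (h : IsPullback q s (Γ.H.map φ) (Γ.η B)) (hφ : Γ.E (Γ.H.map φ))
    {t : Γ.I.obj P ⟶ Y} (ht : Γ.η P ≫ Γ.H.map t = q) : t ≫ φ = Γ.I.map s ∧ IsIso t := by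
  have hw : t ≫ φ = Γ.I.map s := by
    apply Γ.reflection_hom_ext
    rw [Functor.map_comp, reassoc_of% ht, η_naturality, h.w]
  have hs : Γ.E (Γ.H.map (Γ.I.map s)) := Γ.map_mem _ (MorphismProperty.of_isPullback h hφ)
  have := Γ.hasPullbacks.hasPullback (Γ.η B) hs
  have h' := IsPullback.of_hasPullback (Γ.H.map (Γ.I.map s)) (Γ.η B)
  -- Fullness applied to the comparison from `P` to the pullback of `HI(s)` produces the inverse `σ`
  -- of `t`; faithfulness gives `σ ≫ t = 𝟙`.
  obtain ⟨σ, hσ, hσ'⟩ := hadm.exists_map h h' hφ hs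
    (pullback.lift (Γ.η P) s (Γ.η_naturality s)) (pullback.lift_snd _ _ _)
  rw [pullback.lift_fst] at hσ'
  refine ⟨hw, σ, ?_, ?_⟩
  · apply Γ.reflection_hom_ext
    rw [Functor.map_comp, reassoc_of% ht, ← hσ', CategoryTheory.Functor.map_id, Category.comp_id]
  · refine hadm.hom_ext h hφ hφ (φ' := φ) (by rw [Category.assoc, hw, hσ]) (Category.id_comp _) ?_
    rw [Functor.map_comp, ← reassoc_of% hσ', ht, CategoryTheory.Functor.map_id, Category.comp_id]

/-- Every extension has a trivial reflection. -/
lemma exists_trivialization (hadm : Γ.IsAdmissible) {X B : C} (x : X ⟶ B) (hx : Γ.E x) :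
    ∃ (Z : C) (z : Z ⟶ B) (r : X ⟶ Z), r ≫ z = x ∧ Γ.E z ∧ Γ.IsTrivial z ∧ IsIso (Γ.I.map r) := by
  have hx' : Γ.E (Γ.H.map (Γ.I.map x)) := Γ.map_mem _ hx
  have := Γ.hasPullbacks.hasPullback (Γ.η B) hx'
  let P : C := pullback (Γ.H.map (Γ.I.map x)) (Γ.η B)
  let q : P ⟶ Γ.H.obj (Γ.I.obj X) := pullback.fst _ _
  let s : P ⟶ B := pullback.snd _ _
  have hP : IsPullback q s (Γ.H.map (Γ.I.map x)) (Γ.η B) := IsPullback.of_hasPullback _ _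
  obtain ⟨t, ht⟩ := Γ.exists_reflection_desc q
  obtain ⟨hw, _⟩ := hadm.isIso_of_isPullback hP hx' ht
  refine ⟨P, s, hP.lift (Γ.η X) x (Γ.η_naturality x), hP.lift_snd _ _ _,
    MorphismProperty.of_isPullback hP hx', ?_, ?_⟩
  -- Replacing the corner `HI(X)` by `HI(P)` along `t` turns the defining pullback of `P` into the
  -- naturality square of `s`.
  · refine hP.of_iso (Iso.refl _) (Γ.H.mapIso (asIso t)).symm (Iso.refl _) (Iso.refl _) ?_ ?_ ?_ ?_
    · rw [Iso.symm_hom, Iso.comp_inv_eq, Iso.refl_hom, Category.id_comp]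
      exact ht.symm
    · simp
    · rw [Iso.symm_hom, Iso.eq_inv_comp, ← hw, Functor.map_comp, Iso.refl_hom, Category.comp_id]
      rfl
    · simp
  · have : Γ.I.map (hP.lift (Γ.η X) x (Γ.η_naturality x)) ≫ t = 𝟙 _ := by
      apply Γ.reflection_hom_ext
      rw [Functor.map_comp, reassoc_of% η_naturality Γ, ht, hP.lift_fst, CategoryTheory.Functor.map_id,
        Category.comp_id]
    rw [← IsIso.eq_comp_inv] at this
    rw [this]
    infer_instance

lemma isIso_of_isIso_map {Z Z' B : C} {z : Z ⟶ B} {z' : Z' ⟶ B} (hz : Γ.IsTrivial z)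
    (hz' : Γ.IsTrivial z') {r : Z ⟶ Z'} (w : r ≫ z' = z) (hr : IsIso (Γ.I.map r)) : IsIso r := by
  obtain ⟨s, hs, hs'⟩ := hz.exists_lift hr (𝟙 Z) z' (by simp [w])
  refine ⟨s, hs, hz'.hom_ext hr ?_ ?_⟩
  · rw [reassoc_of% hs, Category.comp_id]
  · rw [Category.assoc, w, hs', Category.id_comp]

/-- Locality of `z` extends `a` along the trivialization unit of `z'`, which gives a retraction of
that unit; locality of the trivialization makes it an inverse. -/
lemma IsTrivial.of_isPullback (hadm : Γ.IsAdmissible) {Z B Z' B' : C} {a : Z' ⟶ Z} {z' : Z' ⟶ B'}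
    {z : Z ⟶ B} {b : B' ⟶ B} (h : IsPullback a z' z b) (hE : Γ.E z) (hz : Γ.IsTrivial z) :
    Γ.IsTrivial z' := by
  obtain ⟨Y, y, r, hr, -, hy, hI⟩ :=
    exists_trivialization hadm z' (MorphismProperty.of_isPullback h hE)
  obtain ⟨s, hs, hs'⟩ := hz.exists_lift hI a (y ≫ b) (by rw [h.w, reassoc_of% hr])
  let s' : Y ⟶ Z' := h.lift s y hs'
  have h₁ : r ≫ s' = 𝟙 Z' := h.hom_ext (by simp [s', hs]) (by simp [s', hr])
  have h₂ : s' ≫ r = 𝟙 Y := hy.hom_ext hI (by rw [reassoc_of% h₁, Category.comp_id])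
    (by rw [Category.assoc, hr, h.lift_snd, Category.id_comp])
  exact hy.of_iso ⟨r, s', h₁, h₂⟩ hr

/-- A comparison between two pullbacks along a split epimorphism is inverted by the reflector as
soon as the comparison of the pulled back morphisms is. -/
lemma isIso_map_of_isPullback {A A' B D P P' : C} {f : A ⟶ B} {f' : A' ⟶ B} {g : D ⟶ B}
    {a : P ⟶ A} {d : P ⟶ D} {a' : P' ⟶ A'} {d' : P' ⟶ D} (h : IsPullback a d f g)
    (h' : IsPullback a' d' f' g) (hl : PreservesLimit (cospan f g) Γ.I)
    (hl' : PreservesLimit (cospan f' g) Γ.I) {r : A ⟶ A'} (hr : r ≫ f' = f) {q : P ⟶ P'}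
    (hqa : q ≫ a' = a ≫ r) (hqd : q ≫ d' = d) (hI : IsIso (Γ.I.map r)) : IsIso (Γ.I.map q) := by
  have h₁ := h.map Γ.I
  have h₂ := h'.map Γ.I
  have h₃ : IsPullback (Γ.I.map a ≫ Γ.I.map r) (Γ.I.map d) (Γ.I.map f') (Γ.I.map g) :=
    h₁.of_iso (Iso.refl _) (asIso (Γ.I.map r)) (Iso.refl _) (Iso.refl _) (by simp) (by simp)
      (by simp [← hr]) (by simp)
  have : Γ.I.map q = (h₃.isoIsPullback _ _ h₂).hom := by
    apply h₂.hom_ext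
    · simp [← Functor.map_comp, hqa]
    · simp [← Functor.map_comp, hqd]
  rw [this]
  infer_instance

/-! ### Splitting, and normality of coverings -/

/-- The reflector preserves pullbacks of pairs of extensions one of which is a split epimorphism. -/
abbrev PreservesSplitPullbacks (Γ : GaloisStructure C) : Prop :=
  ∀ (A B D : C) (f : A ⟶ B) (g : D ⟶ B), Γ.E f → Γ.E g → IsSplitEpi g →
    PreservesLimit (cospan f g) Γ.I

lemma IsTrivial.of_isPullback_of_isPullback (hadm : Γ.IsAdmissible) {A B D Q Z Z' : C} {f : A ⟶ B}
    {p : D ⟶ B} {q : Q ⟶ B} {a : Z ⟶ A} {z : Z ⟶ D} {a' : Z' ⟶ A} {z' : Z' ⟶ Q}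
    (h : IsPullback a z f p) (h' : IsPullback a' z' f q) (hf : Γ.E f) (hz : Γ.IsTrivial z)
    (e : Q ⟶ D) (he : e ≫ p = q) : Γ.IsTrivial z' := by
  subst he
  exact IsTrivial.of_isPullback hadm (IsPullback.of_right' h' h)
    (MorphismProperty.of_isPullback h hf) hz

variable (Γ) in
/-- The projection from the pullback `p^*(f)` to the domain of `f`. -/
noncomputable def pullbackFst {B D : C} (f : Γ.Slice B) (p : D ⟶ B) :
    ((Γ.pullbackFunctor p).obj f).left ⟶ f.left :=
  pullback.fst f.hom p

lemma pullbackFunctor_map_fst {B D : C} {f g : Γ.Slice B} (r : f ⟶ g) (p : D ⟶ B) :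
    ((Γ.pullbackFunctor p).map r).left ≫ Γ.pullbackFst g p = Γ.pullbackFst f p ≫ r.left :=
  pullback.lift_fst (f := g.hom) (g := p) _ _ _

lemma isPullback_pullbackFunctor {B D : C} (f : Γ.Slice B) (p : D ⟶ B) :
    IsPullback (Γ.pullbackFst f p) ((Γ.pullbackFunctor p).obj f).hom f.hom p :=
  IsPullback.of_hasPullback f.hom p

lemma isSplitBy_iff {B : C} (f p : Γ.Slice B) {Z : C} {a : Z ⟶ f.left} {z : Z ⟶ p.left}
    (h : IsPullback a z f.hom p.hom) : Γ.IsSplitBy f p ↔ Γ.IsTrivial z := by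
  let e := h.isoIsPullback _ _ (isPullback_pullbackFunctor f p.hom)
  exact ⟨fun h' ↦ IsTrivial.of_iso h' e (h.isoIsPullback_hom_snd _ _ _),
    fun h' ↦ IsTrivial.of_iso h' e.symm (h.isoIsPullback_inv_snd _ _ _)⟩

lemma isIso_of_isIso_left {B : C} {f g : Γ.Slice B} (r : f ⟶ g) (h : IsIso r.left) : IsIso r :=
  (MorphismProperty.Over.isoMk (asIso r.left) (MorphismProperty.Over.w r)).isIso_hom

/-- The trivialization unit of `g` becomes invertible under `p^*`, being inverted by `I` between
trivial coverings; a monadic `p^*` reflects isomorphisms. -/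
lemma IsTrivial.of_isPullback_of_isSplitEpi (hadm : Γ.IsAdmissible) (hI : Γ.PreservesSplitPullbacks)
    {B D : C} {g : D ⟶ B} (hg : Γ.E g) [IsSplitEpi g] (p : Γ.Slice B)
    (hp : Γ.IsMonadicExtension p) {Z : C} {a : Z ⟶ D} {z : Z ⟶ p.left}
    (h : IsPullback a z g p.hom) (hz : Γ.IsTrivial z) : Γ.IsTrivial g := by
  obtain ⟨Y, y, r, hr, hyE, hy, hrI⟩ := exists_trivialization hadm g hg
  -- Here `p` need not split, so both `g` and `y` must be split for `I` to preserve their pullbacks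
  -- along `p`.
  have : IsSplitEpi y := IsSplitEpi.mk' ⟨section_ g ≫ r, by simp [hr]⟩
  let G : Γ.Slice B := MorphismProperty.Over.mk ⊤ g hg
  let G' : Γ.Slice B := MorphismProperty.Over.mk ⊤ y hyE
  let ρ : G ⟶ G' := MorphismProperty.Over.homMk r hr
  have hG := isPullback_pullbackFunctor G p.hom
  have hG' := isPullback_pullbackFunctor G' p.hom
  have h₁ : PreservesLimit (cospan G.hom p.hom) Γ.I :=
    have := hI _ _ _ _ _ p.prop hg inferInstance
    preservesPullback_symmetry Γ.I p.hom g
  have h₂ : PreservesLimit (cospan G'.hom p.hom) Γ.I :=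
    have := hI _ _ _ _ _ p.prop hyE inferInstance
    preservesPullback_symmetry Γ.I p.hom y
  let R := Γ.pullbackFunctor p.hom
  have hsnd : (R.map ρ).left ≫ (R.obj G').hom = (R.obj G).hom := MorphismProperty.Over.w _
  have hzG : Γ.IsTrivial (R.obj G).hom := (isSplitBy_iff G p h).2 hz
  have hzG' : Γ.IsTrivial (R.obj G').hom := IsTrivial.of_isPullback hadm hG' hyE hy
  have : IsIso (R.map ρ) :=
    isIso_of_isIso_left _ (isIso_of_isIso_map hzG hzG' hsnd
      (isIso_map_of_isPullback hG hG' h₁ h₂ hr (pullbackFunctor_map_fst ρ p.hom) hsnd hrI))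
  obtain ⟨_⟩ := hp
  have : IsIso ((Monad.comparison (monadicAdjunction R)).map ρ) :=
    have : IsIso ((monadicAdjunction R).toMonad.forget.map
      ((Monad.comparison (monadicAdjunction R)).map ρ)) := this
    isIso_of_reflects_iso _ (monadicAdjunction R).toMonad.forget
  have : IsIso ρ := isIso_of_reflects_iso _ (Monad.comparison (monadicAdjunction R))
  let e : G ≅ G' := asIso ρ
  exact hy.of_iso ⟨ρ.left, e.inv.left, congrArg (fun t ↦ t.left) e.hom_inv_id,
    congrArg (fun t ↦ t.left) e.inv_hom_id⟩ hr

/-- An extension which is split by some monadic extension is split by itself. -/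
lemma IsCovering.isSplitBy_self (hadm : Γ.IsAdmissible) (hI : Γ.PreservesSplitPullbacks)
    (hmon : ∀ (B : C) (p : Γ.Slice B), Γ.IsMonadicExtension p) {B : C} {f : Γ.Slice B}
    (hf : Γ.IsCovering f) : Γ.IsSplitBy f f := by
  obtain ⟨p, -, hp⟩ := hf
  have hK := isPullback_pullbackFunctor f f.hom
  have hP := isPullback_pullbackFunctor f p.hom
  let K := (Γ.pullbackFunctor f.hom).obj f
  let Q := (Γ.pullbackFunctor f.hom).obj p
  have hQ := isPullback_pullbackFunctor p f.hom
  have hM := isPullback_pullbackFunctor K Q.hom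
  have : IsSplitEpi K.hom := IsSplitEpi.mk' ⟨hK.lift (𝟙 _) (𝟙 _) rfl, hK.lift_snd _ _ _⟩
  have hKt : Γ.IsTrivial K.hom := by
    refine IsTrivial.of_isPullback_of_isSplitEpi hadm hI K.prop Q (hmon _ Q) hM ?_
    -- The pullback of `K` along `Q` is that of `f` along `Q.hom ≫ f.hom`, which factors through
    -- `p`.
    exact IsTrivial.of_isPullback_of_isPullback hadm hP (hM.paste_horiz hK) f.prop
      ((isSplitBy_iff f p hP).1 hp) _ hQ.w
  exact (isSplitBy_iff f f hK).2 hKt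

/-! ### Reflectivity of split extensions and of coverings -/

/-- The monad `p^* p_!` preserves the morphisms which are inverted by the reflector. -/
lemma isIso_map_of_isPullback_comp (hI : Γ.PreservesSplitPullbacks) {B D K X Y P P' : C}
    {x : X ⟶ D} {y : Y ⟶ D} {p : D ⟶ B} {k₁ k₂ : K ⟶ D} {a : P ⟶ X} {d : P ⟶ D} {a' : P' ⟶ Y}
    {d' : P' ⟶ D} (hx : Γ.E x) (hy : Γ.E y) (hp : Γ.E p) (hK : IsPullback k₁ k₂ p p)
    (hX : IsPullback a d (x ≫ p) p) (hY : IsPullback a' d' (y ≫ p) p) {g : X ⟶ Y} (hg : g ≫ y = x)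
    {q : P ⟶ P'} (hqa : q ≫ a' = a ≫ g) (hqd : q ≫ d' = d) (hgI : IsIso (Γ.I.map g)) :
    IsIso (Γ.I.map q) := by
  have hk : IsSplitEpi k₁ := IsSplitEpi.mk' ⟨hK.lift (𝟙 _) (𝟙 _) rfl, hK.lift_fst _ _ _⟩
  have hkE := MorphismProperty.of_isPullback hK.flip hp
  -- Pullback cancellation exhibits `P` and `P'` as the pullbacks of `x` and `y` along `k₁`, which
  -- the diagonal splits.
  refine isIso_map_of_isPullback (IsPullback.of_right' hX.flip hK.flip).flip
    (IsPullback.of_right' hY.flip hK.flip).flip (hI _ _ _ _ _ hx hkE hk) (hI _ _ _ _ _ hy hkE hk)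
    hg hqa ?_ hgI
  apply hK.flip.hom_ext
  · rw [Category.assoc, IsPullback.lift_fst, IsPullback.lift_fst, hqd]
  · rw [Category.assoc, IsPullback.lift_snd, IsPullback.lift_snd, reassoc_of% hqa, hg]

variable (Γ) in
/-- The functor `(C ↓ B) ⥤ X` which sends `(A, f)` to `I(A)`. -/
def sliceReflector (B : C) : Γ.Slice B ⥤ Γ.X.FullSubcategory where
  obj f := Γ.I.obj f.left
  map r := Γ.I.map r.left
  map_id _ := Γ.I.map_id _
  map_comp _ _ := Γ.I.map_comp _ _

/-- The extensions of `B` which are split by a fixed extension are reflective. -/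
lemma exists_isSplitBy_reflection (hadm : Γ.IsAdmissible) (hI : Γ.PreservesSplitPullbacks) {B : C}
    (p : Γ.Slice B) (hp : Γ.IsMonadicExtension p) (f : Γ.Slice B) :
    ∃ (f' : Γ.Slice B) (r : f ⟶ f'), Γ.IsSplitBy f' p ∧
      ∀ g : Γ.Slice B, Γ.IsSplitBy g p → Function.Bijective fun t : f' ⟶ g ↦ r ≫ t := by
  obtain ⟨_⟩ := hp
  have := Γ.comp
  let R := Γ.pullbackFunctor p.hom
  let P : ObjectProperty (Γ.Slice p.left) := fun x ↦ Γ.IsTrivial x.hom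
  let W : MorphismProperty (Γ.Slice p.left) :=
    (MorphismProperty.isomorphisms _).inverseImage (Γ.sliceReflector p.left)
  have : P.IsClosedUnderIsomorphisms := ⟨fun {X Y} e hX ↦ hX.of_iso
    ⟨e.inv.left, e.hom.left, congrArg (fun t ↦ t.left) e.inv_hom_id,
      congrArg (fun t ↦ t.left) e.hom_inv_id⟩ (MorphismProperty.Over.w _)⟩
  refine MonadicRightAdjoint.exists_reflection R P W ?_ ?_ ?_ f
  · intro X Y g hg
    let L := MorphismProperty.Over.map ⊤ p.prop
    -- The left adjoint is, up to isomorphism, composition with `p`.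
    let e : monadicLeftAdjoint R ≅ L := (monadicAdjunction R).leftAdjointUniq
      (MorphismProperty.Over.mapPullbackAdj Γ.E ⊤ p.hom p.prop trivial)
    rw [W.arrow_mk_iso_iff (Arrow.isoMk (R.mapIso (e.app X)) (R.mapIso (e.app Y))
      (by simp [← Functor.map_comp]) : Arrow.mk (R.map ((monadicLeftAdjoint R).map g)) ≅
        Arrow.mk (R.map (L.map g)))]
    exact isIso_map_of_isPullback_comp hI X.prop Y.prop p.prop
      (isPullback_pullbackFunctor p p.hom) (isPullback_pullbackFunctor (L.obj X) p.hom)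
      (isPullback_pullbackFunctor (L.obj Y) p.hom) (MorphismProperty.Over.w g)
      (pullbackFunctor_map_fst (L.map g) p.hom) (MorphismProperty.Over.w _) hg
  · intro X Y Z g hg hZ
    constructor
    · intro s t hst
      ext
      exact hZ.hom_ext hg (congrArg (fun t ↦ t.left) hst)
        ((MorphismProperty.Over.w s).trans (MorphismProperty.Over.w t).symm)
    · intro x
      obtain ⟨t, ht, ht'⟩ := hZ.exists_lift hg x.left Y.hom
        ((MorphismProperty.Over.w x).trans (MorphismProperty.Over.w g).symm)
      refine ⟨MorphismProperty.Over.homMk t ht', ?_⟩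
      ext
      exact ht
  · intro X
    obtain ⟨Z, z, r, hr, hE, hz, hrI⟩ := exists_trivialization hadm X.hom X.prop
    exact ⟨MorphismProperty.Over.mk ⊤ z hE, MorphismProperty.Over.homMk r hr, hrI, hz⟩

/-- Every extension has a universal morphism over its codomain to an extension which it splits, and
the latter is universal among coverings over varying codomains. -/
lemma exists_isCovering_reflection (hadm : Γ.IsAdmissible) (hI : Γ.PreservesSplitPullbacks)
    (hmon : ∀ (B : C) (p : Γ.Slice B), Γ.IsMonadicExtension p) {A B : C} (f : A ⟶ B) (hf : Γ.E f) :
    ∃ (A' : C) (f' : A' ⟶ B) (r : A ⟶ A') (hf' : Γ.E f'),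
      Γ.IsCovering (MorphismProperty.Over.mk ⊤ f' hf') ∧ r ≫ f' = f ∧
      ∀ {G D : C} (g : G ⟶ D) (hg : Γ.E g), Γ.IsCovering (MorphismProperty.Over.mk ⊤ g hg) →
        ∀ (x : A ⟶ G) (b : B ⟶ D), x ≫ g = f ≫ b →
          ∃! t : A' ⟶ G, r ≫ t = x ∧ t ≫ g = f' ≫ b := by
  let F : Γ.Slice B := MorphismProperty.Over.mk ⊤ f hf
  obtain ⟨F', ρ, hF', hρ⟩ := exists_isSplitBy_reflection hadm hI F (hmon _ F) F
  let A' : C := F'.left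
  let f' : A' ⟶ B := F'.hom
  let r : A ⟶ A' := ρ.left
  have hr : r ≫ f' = f := MorphismProperty.Over.w ρ
  refine ⟨A', f', r, F'.prop, ⟨F, hmon _ F, hF'⟩, hr, fun {G D} g hg hgc x b hxb ↦ ?_⟩
  let γ : Γ.Slice D := MorphismProperty.Over.mk ⊤ g hg
  let N : Γ.Slice B := (Γ.pullbackFunctor b).obj γ
  let n : N.left ⟶ B := N.hom
  let m : N.left ⟶ G := Γ.pullbackFst γ b
  have hN : IsPullback m n g b := isPullback_pullbackFunctor γ b
  have hγ := isPullback_pullbackFunctor γ g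
  have hM := isPullback_pullbackFunctor N f
  -- `f^*(b^*(g))` is the pullback of `g` along `f ≫ b = x ≫ g`, hence of the trivial covering
  -- `g^*(g)` along `x`.
  have hsplit : Γ.IsSplitBy N F := (isSplitBy_iff N F hM).2
    (IsTrivial.of_isPullback_of_isPullback hadm hγ (hM.paste_horiz hN) hg
      ((isSplitBy_iff γ γ hγ).1 (hgc.isSplitBy_self hadm hI hmon)) x hxb)
  let ξ : F ⟶ N := MorphismProperty.Over.homMk (hN.lift x f hxb) (hN.lift_snd _ _ _)
  obtain ⟨τ, hτ⟩ := (hρ N hsplit).2 ξ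
  let t : A' ⟶ N.left := τ.left
  have ht : r ≫ t = hN.lift x f hxb := congrArg (fun u ↦ u.left) hτ
  have htn : t ≫ n = f' := MorphismProperty.Over.w τ
  refine ⟨t ≫ m, ⟨?_, ?_⟩, ?_⟩
  · rw [reassoc_of% ht, hN.lift_fst]
  · rw [Category.assoc, hN.w, reassoc_of% htn]
  · rintro t' ⟨hrt', htg'⟩
    let τ' : F' ⟶ N := MorphismProperty.Over.homMk (hN.lift t' f' htg') (hN.lift_snd _ _ _)
    have e : τ' = τ := by
      apply (hρ N hsplit).1
      refine Eq.trans ?_ hτ.symm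
      ext
      change r ≫ hN.lift t' f' htg' = hN.lift x f hxb
      apply hN.hom_ext
      · rw [Category.assoc, hN.lift_fst, hN.lift_fst, hrt']
      · rw [Category.assoc, hN.lift_snd, hN.lift_snd, hr]
    have e' : hN.lift t' f' htg' = t := congrArg (fun u ↦ u.left) e
    rw [← e', hN.lift_fst]

/-- Every extension has a universal morphism to a covering in the category of extensions. -/
lemma exists_cov_reflection (hadm : Γ.IsAdmissible) (hI : Γ.PreservesSplitPullbacks)
    (hmon : ∀ (B : C) (p : Γ.Slice B), Γ.IsMonadicExtension p) (a : Γ.Ext) :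
    ∃ (c : Γ.Cov) (r : a ⟶ Γ.covInclusion.obj c), ∀ c' : Γ.Cov,
      Function.Bijective fun t : c ⟶ c' ↦ r ≫ Γ.covInclusion.map t := by
  obtain ⟨A', f', r, hf', hcov, hr, huniv⟩ :=
    exists_isCovering_reflection hadm hI hmon a.obj.hom a.property
  let c : Γ.Cov := ⟨Arrow.mk f', hf', hcov⟩
  let ρ : a ⟶ Γ.covInclusion.obj c :=
    ObjectProperty.homMk (Arrow.homMk r (𝟙 _) (hr.trans (Category.comp_id _).symm))
  refine ⟨c, ρ, fun c' ↦ ?_⟩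
  obtain ⟨hE, hc'⟩ := c'.property
  constructor
  · intro s t hst
    have hl : r ≫ s.hom.left = r ≫ t.hom.left := congrArg (fun u ↦ u.hom.left) hst
    -- The unit is the identity on codomains, so only the domain components need the universal
    -- property.
    have hst' : s.hom.right = t.hom.right := by
      have : 𝟙 _ ≫ s.hom.right = 𝟙 _ ≫ t.hom.right := congrArg (fun u ↦ u.hom.right) hst
      exact (Category.id_comp _).symm.trans (this.trans (Category.id_comp _))
    have hs : s.hom.left ≫ c'.obj.hom = f' ≫ s.hom.right := Arrow.w s.hom
    have ht : t.hom.left ≫ c'.obj.hom = f' ≫ s.hom.right := hst' ▸ Arrow.w t.hom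
    ext
    · exact (huniv c'.obj.hom hE hc' (r ≫ s.hom.left) s.hom.right
        (by rw [Category.assoc, hs, reassoc_of% hr])).unique ⟨rfl, hs⟩ ⟨hl.symm, ht⟩
    · exact hst'
  · intro x
    obtain ⟨t, ⟨ht, ht'⟩, -⟩ := huniv c'.obj.hom hE hc' x.hom.left x.hom.right (Arrow.w x.hom)
    refine ⟨ObjectProperty.homMk (Arrow.homMk t x.hom.right ht'), ?_⟩
    ext
    · exact ht
    · exact Category.id_comp _

end GaloisStructure

theorem theorem2 {C : Type u} [Category.{v} C] (Γ : GaloisStructure C)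
    (hadm : Γ.IsAdmissible)
    (hmon : ∀ (B : C) (p : Γ.Slice B), Γ.IsMonadicExtension p)
    (hpres : ∀ (A B D : C) (f : A ⟶ B) (g : D ⟶ B), Γ.E f → Γ.E g → IsSplitEpi g →
      PreservesLimit (cospan f g) Γ.I) :
    Γ.covInclusion.IsRightAdjoint ∧
      ∀ (B : C) (f : Γ.Slice B), Γ.IsCovering f → Γ.IsNormalExtension f := by
  refine ⟨?_, fun B f hf ↦ ⟨hmon B f, hf.isSplitBy_self hadm hpres hmon⟩⟩
  have (a : Γ.Ext) : HasInitial (StructuredArrow a Γ.covInclusion) := by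
    obtain ⟨c, r, hr⟩ := GaloisStructure.exists_cov_reflection hadm hpres hmon a
    refine IsInitial.hasInitial (X := StructuredArrow.mk r) ?_
    exact IsInitial.ofUniqueHom
      (fun s ↦ StructuredArrow.homMk ((hr s.right).2 s.hom).choose ((hr s.right).2 s.hom).choose_spec)
      (fun s m ↦ StructuredArrow.hom_ext _ _ ((hr s.right).1
        ((StructuredArrow.w m).trans ((hr s.right).2 s.hom).choose_spec.symm)))
  exact isRightAdjointOfStructuredArrowInitials _
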